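/- **Theorem 6.5.** A *circle* in the Riemann sphere $\hat{\mathbb C}$ is a Euclidean circle or a line together with $\infty$, with a choice of one of its two complementary open discs as *interior*; the other one is its *exterior*. Suppose that $A,B$ are Möbius transformations for which there are circles $C_1,C_1',C_2,C_2'$ in $\hat{\mathbb C}$ with pairwise disjoint interiors (tangencies are allowed) such that $A$ maps the exterior of $C_1$ onto the interior of $C_1'$ and $B$ maps the exterior of $C_2$ onto the interior of $C_2'$; let $G=\langle A,B\rangle$ (that is, $G$ is a marked classical T-Schottky group on the generators $A,B$). Suppose that $G$ is also generated by two parabolic elements $S$ and $T$. Then there are a pair $(A',B')$ obtained from $(A,B)$ by possibly interchanging the two entries and possibly replacing entries by their inverses, a pair $(S',T')$ obtained from $(S,T)$ in the same way, and an element $h\in G$ such that $$hS'h^{-1}=A' \quad\text{and}\quad \bigl(hT'h^{-1}=B' \ \text{ or } \ hT'h^{-1}=A'B'\bigr).$$ -/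

import Mathlib

/-- The group of Möbius transformations of the Riemann sphere `OnePoint ℂ`: those permutations of
the sphere which are induced by some invertible complex `2 × 2` matrix. It is isomorphic to
`PSL(2, ℂ)`, and its elements are transformations, not matrices. -/
abbrev Mobius : Type :=
  (MulAction.toPermHom (Matrix.GeneralLinearGroup (Fin 2) ℂ) (OnePoint ℂ)).range

/-- A Möbius transformation is parabolic if it is induced by a parabolic matrix, i.e. by a
non-scalar matrix whose characteristic polynomial has discriminant `tr² - 4 det` equal to `0`. -/
def Mobius.IsParabolic (f : Mobius) : Prop :=
  ∃ M : Matrix.GeneralLinearGroup (Fin 2) ℂ,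
    M.IsParabolic ∧ ∀ z : OnePoint ℂ, f • z = M • z

/-- A circle in the Riemann sphere (a Euclidean circle, or a line together with `∞`) with a choice
of which of its two sides is called the interior. It is the zero set of
`a |z|² + 2 Re (conj b * z) + c`, where `a c < |b|²`; the interior is the side where this
expression is negative. -/
structure OrientedCircle where
  a : ℝ
  b : ℂ
  c : ℝ
  nondegenerate : a * c < Complex.normSq b

namespace OrientedCircle

/-- The expression `a |z|² + 2 Re (conj b * z) + c`; at `∞` its sign is that of the coefficient
of the leading term `|z|²`. -/
def form (C : OrientedCircle) (z : OnePoint ℂ) : ℝ :=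
  z.elim C.a fun w ↦ C.a * Complex.normSq w + 2 * ((starRingEnd ℂ) C.b * w).re + C.c

/-- The interior of an oriented circle: an open disc in the Riemann sphere. -/
def interior (C : OrientedCircle) : Set (OnePoint ℂ) := {z | C.form z < 0}

/-- The exterior of an oriented circle: the complementary open disc in the Riemann sphere. -/
def exterior (C : OrientedCircle) : Set (OnePoint ℂ) := {z | 0 < C.form z}

end OrientedCircle

/-- The circles `C i`, `C' i` with the side pairings `g i` form a classical T-Schottky
configuration: the interiors of the `2n` circles are pairwise disjoint (the circles may be
tangent), and `g i` maps the exterior of `C i` onto the interior of `C' i`. -/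
structure IsClassicalTSchottkyConfiguration {n : ℕ} (C C' : Fin n → OrientedCircle)
    (g : Fin n → Mobius) : Prop where
  disjoint_interiors :
    Pairwise fun i j : Fin n ⊕ Fin n ↦
      Disjoint (Sum.elim C C' i).interior (Sum.elim C C' j).interior
  image_exterior : ∀ i, (fun z ↦ g i • z) '' (C i).exterior = (C' i).interior

/-- `G` is a marked classical T-Schottky group on the generators `g 0, …, g (n - 1)`. -/
structure IsMarkedClassicalTSchottky {n : ℕ} (G : Subgroup Mobius) (g : Fin n → Mobius) :
    Prop where
  generates : Subgroup.closure (Set.range g) = G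
  exists_configuration :
    ∃ C C' : Fin n → OrientedCircle, IsClassicalTSchottkyConfiguration C C' g

/-- The pair `q` arises from the pair `p` by (possibly) interchanging the two entries and
(possibly) replacing either entry by its inverse. -/
def IsSwapInvOf {Γ : Type*} [Group Γ] (p q : Γ × Γ) : Prop :=
  ∃ x y : Γ, (x = p.1 ∨ x = p.1⁻¹) ∧ (y = p.2 ∨ y = p.2⁻¹) ∧ (q = (x, y) ∨ q = (y, x))

/-! The four closed discs play ping-pong. Hence `G` is free on `A`, `B` (`lift_injective`), and if a
cyclically reduced word represents a parabolic, the fixed point lies in the closed disc of its first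
letter and, by passing to the inverse, in that of the inverse of its last letter
(`fixedPoint_notMem_exterior`). Two of the discs meet in at most one point because a third disc lies
outside both (`eq_of_notMem_exterior`), so first and last letter together determine the fixed point.
The fixed points of `S` and `T` differ, since otherwise the two generators would commute. So no
simultaneous conjugates of `S` and `T^±1` that are cyclically reduced agree in both first and last
letter: in the Cayley tree the axes share at most one edge (`noCommonTurn`).

The rest is Nielsen cancellation in the free group of rank two. If the axes share no edge, a core of
each generator survives in every reduced product, so a single letter can be generated only if it is
a generator up to inversion; the pair then consists of the free generators. If they share one edge
`x`, the pair is, after conjugation and inversion, `x s`, `x t`. With `s` and `t` both nonempty, the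
same argument shows that `x` is not generated. With `s` empty, the pair `x`, `t` falls under the
first case, which yields `a`, `ab`. -/

/-! ### Homogeneous coordinates on the sphere -/

/-- The vector of homogeneous coordinates of a point of the Riemann sphere. -/
def sphereVec (z : OnePoint ℂ) : Fin 2 → ℂ := z.elim ![1, 0] fun w ↦ ![w, 1]

@[simp] lemma sphereVec_infty : sphereVec OnePoint.infty = ![1, 0] := rfl

@[simp] lemma sphereVec_coe (w : ℂ) : sphereVec (w : OnePoint ℂ) = ![w, 1] := rfl

lemma sphereVec_ne_zero (z : OnePoint ℂ) : sphereVec z ≠ 0 := by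
  intro h
  cases z with
  | infty => simpa using congrFun h 0
  | coe w => simpa using congrFun h 1

lemma exists_eq_smul_sphereVec {v : Fin 2 → ℂ} (hv : v ≠ 0) :
    ∃ z, ∃ c : ℂ, c ≠ 0 ∧ v = c • sphereVec z := by
  by_cases h : v 1 = 0
  · refine ⟨OnePoint.infty, v 0, fun h0 ↦ hv ?_, ?_⟩ <;> ext i <;> fin_cases i <;> simp_all
  · refine ⟨((v 0 / v 1 : ℂ) : OnePoint ℂ), v 1, h, ?_⟩
    ext i
    fin_cases i <;> simp
    field_simp

lemma sphereVec_det_eq_zero_iff {z w : OnePoint ℂ} :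
    sphereVec z 0 * sphereVec w 1 - sphereVec z 1 * sphereVec w 0 = 0 ↔ z = w := by
  cases z <;> cases w <;> simp [sub_eq_zero]

lemma eq_of_smul_sphereVec_eq {z w : OnePoint ℂ} {c d : ℂ} (hc : c ≠ 0)
    (h : c • sphereVec z = d • sphereVec w) : z = w := by
  rw [← sphereVec_det_eq_zero_iff]
  have h0 := congrFun h 0
  have h1 := congrFun h 1
  simp only [Pi.smul_apply, smul_eq_mul] at h0 h1
  refine (mul_eq_zero.1 (?_ : c * _ = 0)).resolve_left hc
  linear_combination sphereVec w 1 * h0 - sphereVec w 0 * h1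

lemma exists_eq_add_smul_sphereVec {z w : OnePoint ℂ} (h : z ≠ w) (v : Fin 2 → ℂ) :
    ∃ s t : ℂ, v = s • sphereVec z + t • sphereVec w := by
  have hd := mt sphereVec_det_eq_zero_iff.1 h
  set d := sphereVec z 0 * sphereVec w 1 - sphereVec z 1 * sphereVec w 0 with hdd
  refine ⟨(v 0 * sphereVec w 1 - v 1 * sphereVec w 0) / d,
    (sphereVec z 0 * v 1 - sphereVec z 1 * v 0) / d, ?_⟩
  ext i
  fin_cases i <;> simp <;> field_simp <;> rw [hdd] <;> ring

lemma exists_mulVec_sphereVec (M : Matrix.GeneralLinearGroup (Fin 2) ℂ) (z : OnePoint ℂ) :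
    ∃ c : ℂ, c ≠ 0 ∧ M.1.mulVec (sphereVec z) = c • sphereVec (M • z) := by
  have hdet := M.det_ne_zero
  rw [Matrix.det_fin_two] at hdet
  cases z with
  | infty =>
    rw [OnePoint.smul_infty_eq_ite]
    split_ifs with h
    · refine ⟨M 0 0, fun h0 ↦ hdet (by simp [h0, h]), ?_⟩
      ext i
      fin_cases i <;> simp [h]
    · refine ⟨M 1 0, h, ?_⟩
      ext i
      fin_cases i <;> simp
      field_simp
  | coe w =>
    rw [OnePoint.smul_some_eq_ite]
    split_ifs with h
    · refine ⟨M 0 0 * w + M 0 1, fun h0 ↦ ?_, ?_⟩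
      · apply hdet
        by_cases hw : M 1 0 = 0
        · simp_all
        · refine (mul_eq_zero.1 (?_ : M 1 0 * _ = 0)).resolve_left hw
          linear_combination M 1 0 * M 0 0 * h - M 1 0 * M 1 0 * h0
      · ext i
        fin_cases i <;> simp [h]
    · refine ⟨M 1 0 * w + M 1 1, h, ?_⟩
      ext i
      fin_cases i <;> simp
      exact (mul_div_cancel₀ _ h).symm

lemma Mobius.exists_matrix (f : Mobius) :
    ∃ M : Matrix.GeneralLinearGroup (Fin 2) ℂ, ∀ z : OnePoint ℂ, f • z = M • z := by
  obtain ⟨f, M, rfl⟩ := f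
  exact ⟨M, fun z ↦ rfl⟩

lemma Mobius.ext_smul {f g : Mobius} (h : ∀ z : OnePoint ℂ, f • z = g • z) : f = g :=
  Subtype.ext (Equiv.ext h)

/-! ### Circles as indefinite Hermitian forms -/

namespace OrientedCircle

/-- The Hermitian form on `ℂ²` which describes an oriented circle. -/
def hermitian (C : OrientedCircle) (v : Fin 2 → ℂ) : ℝ :=
  C.a * Complex.normSq (v 0) + 2 * ((starRingEnd ℂ) C.b * (v 0 * (starRingEnd ℂ) (v 1))).re +
    C.c * Complex.normSq (v 1)

variable (C : OrientedCircle)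

lemma mem_interior_iff {z : OnePoint ℂ} : z ∈ C.interior ↔ C.form z < 0 := Iff.rfl

lemma mem_exterior_iff {z : OnePoint ℂ} : z ∈ C.exterior ↔ 0 < C.form z := Iff.rfl

lemma hermitian_sphereVec (z : OnePoint ℂ) : C.hermitian (sphereVec z) = C.form z := by
  cases z <;> simp [hermitian, form]

lemma hermitian_smul (c : ℂ) (v : Fin 2 → ℂ) :
    C.hermitian (c • v) = Complex.normSq c * C.hermitian v := by
  simp [hermitian, Complex.normSq_apply]
  ring

lemma hermitian_add_smul (v w : Fin 2 → ℂ) (t : ℝ) :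
    C.hermitian (v + (t : ℂ) • w) = C.hermitian v +
      t * (C.hermitian (v + w) - C.hermitian v - C.hermitian w) + t ^ 2 * C.hermitian w := by
  simp [hermitian, Complex.normSq_apply]
  ring

lemma hermitian_parallelogram (v w : Fin 2 → ℂ) :
    C.hermitian (v + w) + C.hermitian (v - w) = 2 * (C.hermitian v + C.hermitian w) := by
  simp [hermitian, Complex.normSq_apply]
  ring

lemma continuous_hermitian : Continuous C.hermitian := by
  unfold hermitian
  have := Complex.continuous_normSq
  fun_prop

lemma hermitian_smul_sphereVec_neg {c : ℂ} (hc : c ≠ 0) {z : OnePoint ℂ} :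
    C.hermitian (c • sphereVec z) < 0 ↔ z ∈ C.interior := by
  have := Complex.normSq_pos.2 hc
  rw [hermitian_smul, hermitian_sphereVec, mem_interior_iff]
  constructor <;> intro h <;> nlinarith

lemma hermitian_smul_sphereVec_pos {c : ℂ} (hc : c ≠ 0) {z : OnePoint ℂ} :
    0 < C.hermitian (c • sphereVec z) ↔ z ∈ C.exterior := by
  rw [hermitian_smul, hermitian_sphereVec, mem_exterior_iff,
    mul_pos_iff_of_pos_left (Complex.normSq_pos.2 hc)]

/-- The gradient of the Hermitian form. -/
def gradient (v : Fin 2 → ℂ) : Fin 2 → ℂ :=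
  ![C.a * v 0 + C.b * v 1, (starRingEnd ℂ) C.b * v 0 + C.c * v 1]

lemma hermitian_add_smul_gradient (v : Fin 2 → ℂ) (t : ℝ) :
    C.hermitian (v + (t : ℂ) • C.gradient v) = C.hermitian v +
      t * (2 * (Complex.normSq (C.gradient v 0) + Complex.normSq (C.gradient v 1)) +
        t * C.hermitian (C.gradient v)) := by
  simp [hermitian, Complex.normSq_apply, gradient]
  ring

/-- The gradient is the Hermitian matrix applied to `v`, and the determinant `a c - |b|²` of that
matrix is nonzero. -/
lemma gradient_normSq_pos {v : Fin 2 → ℂ} (hv : v ≠ 0) :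
    0 < Complex.normSq (C.gradient v 0) + Complex.normSq (C.gradient v 1) := by
  have h0 := Complex.normSq_nonneg (C.gradient v 0)
  have h1 := Complex.normSq_nonneg (C.gradient v 1)
  by_contra! h
  have e0 : C.gradient v 0 = 0 := Complex.normSq_eq_zero.1 (by linarith)
  have e1 : C.gradient v 1 = 0 := Complex.normSq_eq_zero.1 (by linarith)
  simp only [gradient, Matrix.cons_val_zero, Matrix.cons_val_one] at e0 e1
  have hd : (C.a * C.c - C.b * (starRingEnd ℂ) C.b : ℂ) ≠ 0 := by
    rw [Complex.mul_conj]
    have := C.nondegenerate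
    exact_mod_cast (sub_neg.2 this).ne
  apply hv
  ext i
  fin_cases i
  · refine (mul_eq_zero.1 (?_ : (C.a * C.c - C.b * (starRingEnd ℂ) C.b : ℂ) * _ = 0)).resolve_left hd
    simp only [Fin.zero_eta]
    linear_combination C.c * e0 - C.b * e1
  · refine (mul_eq_zero.1 (?_ : (C.a * C.c - C.b * (starRingEnd ℂ) C.b : ℂ) * _ = 0)).resolve_left hd
    simp only [Fin.mk_one]
    linear_combination C.a * e1 - (starRingEnd ℂ) C.b * e0

lemma tendsto_add_smul_gradient (v : Fin 2 → ℂ) (s : Set ℝ) :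
    Filter.Tendsto (fun t : ℝ ↦ v + (t : ℂ) • C.gradient v) (nhdsWithin 0 s) (nhds v) := by
  have : Continuous fun t : ℝ ↦ v + (t : ℂ) • C.gradient v := by fun_prop
  simpa using (this.tendsto 0).mono_left nhdsWithin_le_nhds

lemma eventually_gradient_pos {v : Fin 2 → ℂ} (hv : v ≠ 0) (s : Set ℝ) :
    ∀ᶠ t in nhdsWithin (0 : ℝ) s,
      0 < 2 * (Complex.normSq (C.gradient v 0) + Complex.normSq (C.gradient v 1)) +
        t * C.hermitian (C.gradient v) := by
  have hc : Continuous fun t : ℝ ↦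
      2 * (Complex.normSq (C.gradient v 0) + Complex.normSq (C.gradient v 1)) +
        t * C.hermitian (C.gradient v) := by fun_prop
  refine ((hc.tendsto 0).mono_left nhdsWithin_le_nhds).eventually_const_lt ?_
  simpa using C.gradient_normSq_pos hv

/-- To first order the form increases along its gradient, so a null vector is a limit of vectors of
either sign. -/
lemma mem_closure_hermitian_pos {v : Fin 2 → ℂ} (hv : v ≠ 0) (h : C.hermitian v = 0) :
    v ∈ closure {w | 0 < C.hermitian w} := by
  refine mem_closure_of_tendsto (C.tendsto_add_smul_gradient v (Set.Ioi 0)) ?_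
  filter_upwards [C.eventually_gradient_pos hv (Set.Ioi 0), self_mem_nhdsWithin] with t ht h0
  rw [hermitian_add_smul_gradient, h, zero_add]
  exact mul_pos h0 ht

lemma mem_closure_hermitian_neg {v : Fin 2 → ℂ} (hv : v ≠ 0) (h : C.hermitian v = 0) :
    v ∈ closure {w | C.hermitian w < 0} := by
  refine mem_closure_of_tendsto (C.tendsto_add_smul_gradient v (Set.Iio 0)) ?_
  filter_upwards [C.eventually_gradient_pos hv (Set.Iio 0), self_mem_nhdsWithin] with t ht h0
  rw [hermitian_add_smul_gradient, h, zero_add]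
  exact mul_neg_of_neg_of_pos h0 ht

lemma interior_nonempty : C.interior.Nonempty := by
  have hC := C.nondegenerate
  rcases lt_trichotomy C.a 0 with h | h | h
  · exact ⟨OnePoint.infty, h⟩
  · have hb : 0 < Complex.normSq C.b := by simpa [h] using hC
    -- For a line, this multiple of `b` gives the form the value `-2 (|c| + 1) + c`.
    refine ⟨((-((|C.c| + 1) / Complex.normSq C.b : ℝ) * C.b : ℂ) : OnePoint ℂ), ?_⟩
    have e : (starRingEnd ℂ) C.b * (-((|C.c| + 1) / Complex.normSq C.b : ℝ) * C.b : ℂ) =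
        ((-(|C.c| + 1) : ℝ) : ℂ) := by
      have hb' : (Complex.normSq C.b : ℂ) ≠ 0 := by exact_mod_cast hb.ne'
      have := Complex.mul_conj C.b
      push_cast
      field_simp
      linear_combination (-1 - ((|C.c| : ℝ) : ℂ)) * this
    rw [mem_interior_iff, form, OnePoint.elim_some, e, h, Complex.ofReal_re]
    linarith [le_abs_self C.c, abs_nonneg C.c]
  -- The Euclidean centre, where the form equals `c - |b|² / a`.
  · refine ⟨((-C.b / C.a : ℂ) : OnePoint ℂ), ?_⟩
    have e : (starRingEnd ℂ) C.b * (-C.b / C.a : ℂ) = ((-(Complex.normSq C.b / C.a) : ℝ) : ℂ) := by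
      have := Complex.mul_conj C.b
      push_cast
      linear_combination (-1 / (C.a : ℂ)) * this
    rw [mem_interior_iff, form, OnePoint.elim_some, e, Complex.ofReal_re]
    simp only [map_div₀, Complex.normSq_neg, Complex.normSq_ofReal]
    field_simp
    linarith

/-- A point of the second open disc lying on the first circle would be a limit of points of the
first disc, so the two interiors would meet. -/
lemma interior_subset_exterior {C C' : OrientedCircle} (h : Disjoint C.interior C'.interior) :
    C'.interior ⊆ C.exterior := by
  intro z hz
  by_contra hz'
  have h1 : ¬ C.form z < 0 := fun h1 ↦ Set.disjoint_left.1 h h1 hz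
  have h0 : C.hermitian (sphereVec z) = 0 := by
    rw [hermitian_sphereVec]
    exact le_antisymm (not_lt.1 hz') (not_lt.1 h1)
  have hopen : IsOpen {w | C'.hermitian w < 0} := isOpen_lt C'.continuous_hermitian continuous_const
  obtain ⟨w, hw', hw⟩ := mem_closure_iff.1 (C.mem_closure_hermitian_neg (sphereVec_ne_zero z) h0)
    _ hopen (by simpa [hermitian_sphereVec, mem_interior_iff] using hz)
  have hw0 : w ≠ 0 := by rintro rfl; simp [hermitian] at hw
  obtain ⟨y, c, hc, rfl⟩ := exists_eq_smul_sphereVec hw0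
  exact Set.disjoint_left.1 h ((C.hermitian_smul_sphereVec_neg hc).1 hw)
    ((C'.hermitian_smul_sphereVec_neg hc).1 hw')

lemma notMem_exterior_of_mem_interior {C : OrientedCircle} {z : OnePoint ℂ} (h : z ∈ C.interior) :
    z ∉ C.exterior := fun h' ↦ lt_asymm (C.mem_interior_iff.1 h) h'

/-- Two disjoint discs which leave room for a third one touch in at most one point. -/
lemma eq_of_notMem_exterior {C₁ C₂ C₃ : OrientedCircle}
    (h₁₂ : Disjoint C₁.interior C₂.interior) (h₁₃ : Disjoint C₁.interior C₃.interior)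
    (h₂₃ : Disjoint C₂.interior C₃.interior) {p q : OnePoint ℂ} (hp₁ : p ∉ C₁.exterior)
    (hp₂ : p ∉ C₂.exterior) (hq₁ : q ∉ C₁.exterior) (hq₂ : q ∉ C₂.exterior) : p = q := by
  have key {C C' : OrientedCircle} (h : Disjoint C.interior C'.interior) {z : OnePoint ℂ}
      (hz : z ∉ C.exterior) (hz' : z ∉ C'.exterior) : C.hermitian (sphereVec z) = 0 := by
    rw [hermitian_sphereVec]
    exact le_antisymm (not_lt.1 hz) (not_lt.1 fun hlt ↦ hz' (interior_subset_exterior h.symm hlt))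
  by_contra hpq
  obtain ⟨x, hx⟩ := C₃.interior_nonempty
  obtain ⟨s, t, hst⟩ := exists_eq_add_smul_sphereVec hpq (sphereVec x)
  -- Here `p` and `q` are null for both forms, so each form takes opposite values at `s p + t q` and
  -- `s p - t q`. The former is a point of the third disc, where both forms are positive; the latter
  -- then lies in both of the first two discs.
  have neg {C : OrientedCircle} (h0 : C.hermitian (sphereVec p) = 0)
      (h1 : C.hermitian (sphereVec q) = 0) (h : Disjoint C.interior C₃.interior) :
      C.hermitian (s • sphereVec p - t • sphereVec q) < 0 := by
    have e := C.hermitian_parallelogram (s • sphereVec p) (t • sphereVec q)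
    have : 0 < C.hermitian (sphereVec x) := by
      rw [hermitian_sphereVec]
      exact interior_subset_exterior h hx
    rw [hermitian_smul, hermitian_smul, h0, h1, ← hst] at e
    linarith
  have n₁ := neg (key h₁₂ hp₁ hp₂) (key h₁₂ hq₁ hq₂) h₁₃
  have n₂ := neg (key h₁₂.symm hp₂ hp₁) (key h₁₂.symm hq₂ hq₁) h₂₃
  have hw0 : s • sphereVec p - t • sphereVec q ≠ 0 := by
    intro h
    rw [h] at n₁
    simp [hermitian] at n₁
  obtain ⟨y, c, hc, e⟩ := exists_eq_smul_sphereVec hw0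
  rw [e] at n₁ n₂
  exact Set.disjoint_left.1 h₁₂ ((C₁.hermitian_smul_sphereVec_neg hc).1 n₁)
    ((C₂.hermitian_smul_sphereVec_neg hc).1 n₂)

/-- If a Möbius transformation maps the exterior of `C` onto the interior of `C'`, then it maps the
interior of `C` onto the exterior of `C'`. -/
lemma smul_mem_exterior_iff {C C' : OrientedCircle} {f : Mobius}
    (h : (fun z ↦ f • z) '' C.exterior = C'.interior) {z : OnePoint ℂ} :
    f • z ∈ C'.exterior ↔ z ∈ C.interior := by
  obtain ⟨M, hM⟩ := f.exists_matrix
  have hv (v : Fin 2 → ℂ) : C'.hermitian (M.1.mulVec v) < 0 ↔ 0 < C.hermitian v := by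
    by_cases hv : v = 0
    · simp [hv, hermitian]
    · obtain ⟨z, c, hc, rfl⟩ := exists_eq_smul_sphereVec hv
      obtain ⟨d, hd, e⟩ := exists_mulVec_sphereVec M z
      rw [Matrix.mulVec_smul, e, smul_smul, hermitian_smul_sphereVec_neg _ (mul_ne_zero hc hd),
        hermitian_smul_sphereVec_pos _ hc, ← hM, ← h]
      exact (MulAction.injective f).mem_set_image
  have hcont : Continuous fun v : Fin 2 → ℂ ↦ M.1.mulVec v := by fun_prop
  have hcont' : Continuous fun v : Fin 2 → ℂ ↦ (M⁻¹).1.mulVec v := by fun_prop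
  have hinv (v : Fin 2 → ℂ) : (M⁻¹).1.mulVec (M.1.mulVec v) = v := by
    rw [Matrix.mulVec_mulVec, ← Units.val_mul, inv_mul_cancel, Units.val_one, Matrix.one_mulVec]
  have hinv' (v : Fin 2 → ℂ) : M.1.mulVec ((M⁻¹).1.mulVec v) = v := by
    rw [Matrix.mulVec_mulVec, ← Units.val_mul, mul_inv_cancel, Units.val_one, Matrix.one_mulVec]
  obtain ⟨d, hd, e⟩ := exists_mulVec_sphereVec M z
  have hz0 := sphereVec_ne_zero z
  rw [← one_smul ℂ (sphereVec z)] at hz0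
  rw [← hermitian_smul_sphereVec_neg _ one_ne_zero, hM, ← hermitian_smul_sphereVec_pos _ hd, ← e,
    one_smul] at *
  set v := sphereVec z
  have hMv0 : M.1.mulVec v ≠ 0 := fun h0 ↦ hz0 (by rw [← hinv v, h0, Matrix.mulVec_zero])
  constructor
  · intro hpos
    -- The hypothesis leaves open only that `v` is null. Then it would be a limit of positive
    -- vectors, whose images are negative, while the image of `v` is positive. The converse is
    -- symmetric.
    have hle : C.hermitian v ≤ 0 := not_lt.1 fun hlt ↦ lt_asymm hpos ((hv v).2 hlt)
    refine lt_of_le_of_ne hle fun h0 ↦ ?_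
    obtain ⟨w, hw, hw'⟩ := mem_closure_iff.1 (C.mem_closure_hermitian_pos hz0 h0)
      {w | 0 < C'.hermitian (M.1.mulVec w)}
      (isOpen_lt continuous_const (C'.continuous_hermitian.comp hcont)) hpos
    exact lt_asymm hw ((hv w).2 hw')
  · intro hneg
    have hle : 0 ≤ C'.hermitian (M.1.mulVec v) :=
      not_lt.1 fun hlt ↦ lt_asymm hneg ((hv v).1 hlt)
    refine lt_of_le_of_ne hle fun h0 ↦ ?_
    obtain ⟨w, hw, hw'⟩ := mem_closure_iff.1 (C'.mem_closure_hermitian_neg hMv0 h0.symm)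
      {w | C.hermitian ((M⁻¹).1.mulVec w) < 0}
      (isOpen_lt (C.continuous_hermitian.comp hcont') continuous_const) (by rwa [Set.mem_ofPred_eq, hinv])
    refine lt_asymm hw ((hv _).1 ?_)
    rwa [hinv']

end OrientedCircle

/-! ### Parabolic transformations as unipotent matrices -/

/-- `f` is a parabolic transformation with fixed point `p`: it is induced by a unipotent matrix
`1 + n ≠ 1` which fixes the vectors over `p`. -/
def Mobius.IsParabolicAt (f : Mobius) (p : OnePoint ℂ) : Prop :=
  ∃ n : Matrix (Fin 2) (Fin 2) ℂ, n ≠ 0 ∧ n * n = 0 ∧ n.mulVec (sphereVec p) = 0 ∧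
    ∀ z, ∃ c : ℂ, c ≠ 0 ∧ sphereVec z + n.mulVec (sphereVec z) = c • sphereVec (f • z)

lemma exists_mulVec_ne_zero {n : Matrix (Fin 2) (Fin 2) ℂ} (hn : n ≠ 0) :
    ∃ v, n.mulVec v ≠ 0 := by
  by_contra! h
  exact hn (Matrix.ext_of_mulVec_single fun i ↦ by rw [h, Matrix.zero_mulVec])

lemma mulVec_sphereVec_ne_zero {n : Matrix (Fin 2) (Fin 2) ℂ} (hn : n ≠ 0) {p z : OnePoint ℂ}
    (hp : n.mulVec (sphereVec p) = 0) (hz : z ≠ p) : n.mulVec (sphereVec z) ≠ 0 := by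
  intro h
  obtain ⟨v, hv⟩ := exists_mulVec_ne_zero hn
  obtain ⟨s, t, rfl⟩ := exists_eq_add_smul_sphereVec hz v
  simp only [Matrix.mulVec_add, Matrix.mulVec_smul, h, hp, smul_zero, add_zero, ne_eq,
    not_true_eq_false] at hv

lemma eq_smul_of_mulVec_eq_zero {n : Matrix (Fin 2) (Fin 2) ℂ} (hn : n ≠ 0) {p : OnePoint ℂ}
    (hp : n.mulVec (sphereVec p) = 0) {v : Fin 2 → ℂ} (hv : n.mulVec v = 0) :
    ∃ c : ℂ, v = c • sphereVec p := by
  by_cases h0 : v = 0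
  · exact ⟨0, by simp [h0]⟩
  · obtain ⟨z, c, hc, rfl⟩ := exists_eq_smul_sphereVec h0
    rw [Matrix.mulVec_smul, smul_eq_zero_iff_right hc] at hv
    by_cases hz : z = p
    · exact ⟨c, by rw [hz]⟩
    · exact absurd hv (mulVec_sphereVec_ne_zero hn hp hz)

namespace Mobius

/-- A parabolic matrix is `a + n` with `n² = 0`, and invertibility forces `a ≠ 0`. Divide by `a`;
the image of `n` is its kernel and gives the fixed point. -/
lemma IsParabolic.exists_isParabolicAt {f : Mobius} (hf : f.IsParabolic) :
    ∃ p, f.IsParabolicAt p := by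
  obtain ⟨M, hM, hfM⟩ := hf
  obtain ⟨a, n, hMan, hn, hn2⟩ := Matrix.isParabolic_iff_exists.1 hM
  rw [pow_two] at hn2
  have ha : a ≠ 0 := by
    rintro rfl
    rw [map_zero, zero_add] at hMan
    have := M.det_ne_zero
    rw [hMan] at this
    have h := congrArg Matrix.det hn2
    rw [Matrix.det_mul, Matrix.det_zero] at h
    exact this (mul_self_eq_zero.1 h)
  obtain ⟨v, hv⟩ := exists_mulVec_ne_zero hn
  obtain ⟨p, c, hc, e⟩ := exists_eq_smul_sphereVec hv
  have hp : n.mulVec (sphereVec p) = 0 := by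
    have := congrArg n.mulVec e
    rw [Matrix.mulVec_mulVec, hn2, Matrix.zero_mulVec, Matrix.mulVec_smul] at this
    exact (smul_eq_zero_iff_right hc).1 this.symm
  refine ⟨p, a⁻¹ • n, smul_ne_zero (inv_ne_zero ha) hn, ?_, ?_, fun z ↦ ?_⟩
  · rw [smul_mul_smul_comm, hn2, smul_zero]
  · rw [Matrix.smul_mulVec, hp, smul_zero]
  · obtain ⟨d, hd, e⟩ := exists_mulVec_sphereVec M z
    refine ⟨a⁻¹ * d, mul_ne_zero (inv_ne_zero ha) hd, ?_⟩
    rw [mul_smul, hfM, ← e, hMan, Matrix.add_mulVec, smul_add, Matrix.smul_mulVec]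
    congr 1
    rw [Matrix.scalar_apply, ← Matrix.smul_one_eq_diagonal, Matrix.smul_mulVec, Matrix.one_mulVec,
      inv_smul_smul₀ ha]

namespace IsParabolicAt

variable {f g : Mobius} {p : OnePoint ℂ}

lemma inv (h : f.IsParabolicAt p) : f⁻¹.IsParabolicAt p := by
  obtain ⟨n, hn, hn2, hp, hf⟩ := h
  refine ⟨-n, neg_ne_zero.2 hn, by simpa using hn2, by rw [Matrix.neg_mulVec, hp, neg_zero],
    fun z ↦ ?_⟩
  obtain ⟨c, hc, e⟩ := hf (f⁻¹ • z)
  rw [smul_inv_smul] at e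
  refine ⟨c⁻¹, inv_ne_zero hc, ?_⟩
  rw [← inv_smul_smul₀ hc (sphereVec z), ← e, Matrix.mulVec_smul, ← smul_add, Matrix.mulVec_add,
    Matrix.neg_mulVec, Matrix.neg_mulVec, Matrix.mulVec_mulVec, hn2, Matrix.zero_mulVec]
  congr 1
  abel

lemma conj (h : f.IsParabolicAt p) (g : Mobius) : (g * f * g⁻¹).IsParabolicAt (g • p) := by
  obtain ⟨n, hn, hn2, hp, hf⟩ := h
  obtain ⟨M, hM⟩ := g.exists_matrix
  have h1 : (M⁻¹).1 * M.1 = 1 := M.inv_val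
  have h2 : M.1 * (M⁻¹).1 = 1 := M.val_inv
  have hpt (z : OnePoint ℂ) : ∃ d : ℂ, d ≠ 0 ∧
      (M⁻¹).1.mulVec (sphereVec (g • z)) = d • sphereVec z := by
    obtain ⟨d, hd, e⟩ := exists_mulVec_sphereVec M z
    refine ⟨d⁻¹, inv_ne_zero hd, ?_⟩
    rw [hM, ← inv_smul_smul₀ hd (sphereVec (M • z)), ← e, Matrix.mulVec_smul, Matrix.mulVec_mulVec,
      h1, Matrix.one_mulVec]
  refine ⟨M.1 * n * (M⁻¹).1, fun h0 ↦ hn ?_, ?_, ?_, fun z ↦ ?_⟩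
  · calc n = ((M⁻¹).1 * M.1) * n * ((M⁻¹).1 * M.1) := by rw [h1, one_mul, mul_one]
      _ = (M⁻¹).1 * (M.1 * n * (M⁻¹).1) * M.1 := by simp only [mul_assoc]
      _ = 0 := by rw [h0, mul_zero, zero_mul]
  · calc M.1 * n * (M⁻¹).1 * (M.1 * n * (M⁻¹).1)
        = M.1 * (n * ((M⁻¹).1 * M.1) * n) * (M⁻¹).1 := by simp only [mul_assoc]
      _ = 0 := by rw [h1, mul_one, hn2, mul_zero, zero_mul]
  · obtain ⟨d, hd, e⟩ := hpt p
    rw [← Matrix.mulVec_mulVec, e, ← Matrix.mulVec_mulVec, Matrix.mulVec_smul, hp, smul_zero,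
      Matrix.mulVec_zero]
  · obtain ⟨d, hd, e⟩ := hpt (g⁻¹ • z)
    rw [smul_inv_smul] at e
    obtain ⟨c, hc, e'⟩ := hf (g⁻¹ • z)
    obtain ⟨b, hb, e''⟩ := exists_mulVec_sphereVec M (f • g⁻¹ • z)
    refine ⟨d * c * b, mul_ne_zero (mul_ne_zero hd hc) hb, ?_⟩
    rw [mul_smul (g * f), mul_smul g, hM, mul_smul (d * c), ← e'', mul_smul, ← Matrix.mulVec_smul M.1,
      ← e', ← Matrix.mulVec_smul M.1, smul_add, ← Matrix.mulVec_smul n, ← e, Matrix.mulVec_add, Matrix.mulVec_mulVec,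
      Matrix.mulVec_mulVec, Matrix.mulVec_mulVec, h2, Matrix.one_mulVec, mul_assoc]

/-- Both nilpotent parts have the line over `p` as kernel and image, so their products vanish and
both compositions are induced by `1 + n + m`. -/
lemma commute (hf : f.IsParabolicAt p) (hg : g.IsParabolicAt p) : f * g = g * f := by
  obtain ⟨n, hn, hn2, hnp, hf⟩ := hf
  obtain ⟨m, hm, hm2, hmp, hg⟩ := hg
  have zero {n m : Matrix (Fin 2) (Fin 2) ℂ} (hm : m ≠ 0) (hnp : n.mulVec (sphereVec p) = 0)
      (hmp : m.mulVec (sphereVec p) = 0) (hm2 : m * m = 0) (v : Fin 2 → ℂ) :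
      n.mulVec (m.mulVec v) = 0 := by
    obtain ⟨c, e⟩ := eq_smul_of_mulVec_eq_zero hm hmp (v := m.mulVec v)
      (by rw [Matrix.mulVec_mulVec, hm2, Matrix.zero_mulVec])
    rw [e, Matrix.mulVec_smul, hnp, smul_zero]
  have comp {f g : Mobius} {n m : Matrix (Fin 2) (Fin 2) ℂ}
      (hf : ∀ z, ∃ c : ℂ, c ≠ 0 ∧ sphereVec z + n.mulVec (sphereVec z) = c • sphereVec (f • z))
      (hg : ∀ z, ∃ c : ℂ, c ≠ 0 ∧ sphereVec z + m.mulVec (sphereVec z) = c • sphereVec (g • z))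
      (h0 : ∀ v, n.mulVec (m.mulVec v) = 0) (z : OnePoint ℂ) : ∃ c : ℂ, c ≠ 0 ∧
      sphereVec z + (n.mulVec (sphereVec z) + m.mulVec (sphereVec z)) =
        c • sphereVec ((f * g) • z) := by
    obtain ⟨c, hc, e⟩ := hg z
    obtain ⟨d, hd, e'⟩ := hf (g • z)
    refine ⟨c * d, mul_ne_zero hc hd, ?_⟩
    rw [mul_smul, mul_smul, ← e', smul_add, ← Matrix.mulVec_smul, ← e, Matrix.mulVec_add, h0]
    abel
  refine ext_smul fun z ↦ ?_
  obtain ⟨c, hc, e⟩ := comp hf hg (zero hm hnp hmp hm2) z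
  obtain ⟨d, hd, e'⟩ := comp hg hf (zero hn hmp hnp hn2) z
  rw [add_comm (m.mulVec _), e] at e'
  exact eq_of_smul_sphereVec_eq hc e'

/-- This is `(1 + n)^k = 1 + k n`. The coefficient passes through `ℝ` to match `hermitian_add_smul`.
-/
lemma pow_smul_sphereVec {n : Matrix (Fin 2) (Fin 2) ℂ} (hn2 : n * n = 0)
    (hf : ∀ z, ∃ c : ℂ, c ≠ 0 ∧ sphereVec z + n.mulVec (sphereVec z) = c • sphereVec (f • z))
    (z : OnePoint ℂ) (k : ℕ) : ∃ c : ℂ, c ≠ 0 ∧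
      sphereVec z + ((k : ℝ) : ℂ) • n.mulVec (sphereVec z) = c • sphereVec (f ^ k • z) := by
  induction k with
  | zero => exact ⟨1, one_ne_zero, by simp⟩
  | succ k ih =>
    obtain ⟨c, hc, e⟩ := ih
    obtain ⟨d, hd, e'⟩ := hf (f ^ k • z)
    refine ⟨c * d, mul_ne_zero hc hd, ?_⟩
    rw [pow_succ', mul_smul, mul_smul, ← e', smul_add, ← Matrix.mulVec_smul n c, ← e,
      Matrix.mulVec_add, Matrix.mulVec_smul, Matrix.mulVec_mulVec, hn2, Matrix.zero_mulVec]
    push_cast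
    module

/-- Closed discs which contain a forward orbit of a parabolic transformation contain its fixed
point. -/
lemma notMem_exterior_of_forall_pow (h : f.IsParabolicAt p) {C : OrientedCircle} {z : OnePoint ℂ}
    (hz : ∀ k : ℕ, f ^ k • z ∉ C.exterior) : p ∉ C.exterior := by
  obtain ⟨n, hn, hn2, hp, hf⟩ := h
  by_cases hzp : z = p
  · simpa [hzp] using hz 0
  obtain ⟨c, e⟩ := eq_smul_of_mulVec_eq_zero hn hp (v := n.mulVec (sphereVec z))
    (by rw [Matrix.mulVec_mulVec, hn2, Matrix.zero_mulVec])
  have hc : c ≠ 0 := by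
    rintro rfl
    exact mulVec_sphereVec_ne_zero hn hp hzp (by rw [e, zero_smul])
  rw [← C.hermitian_smul_sphereVec_pos hc, ← e]
  intro hpos
  set w := n.mulVec (sphereVec z)
  -- Along the orbit the form is a real quadratic polynomial in `k` whose leading coefficient is its
  -- value at a vector over `p`; boundedness above forbids that coefficient to be positive.
  have hle (k : ℕ) : C.hermitian (sphereVec z) + k * (C.hermitian (sphereVec z + w) -
      C.hermitian (sphereVec z) - C.hermitian w) + k ^ 2 * C.hermitian w ≤ 0 := by
    obtain ⟨d, hd, e⟩ := pow_smul_sphereVec hn2 hf z k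
    rw [← C.hermitian_add_smul, e]
    exact not_lt.1 (mt (C.hermitian_smul_sphereVec_pos hd).1 (hz k))
  set q := C.hermitian (sphereVec z)
  set r := C.hermitian (sphereVec z + w) - q - C.hermitian w
  obtain ⟨k, hk⟩ := exists_nat_gt ((|q| + |r|) / C.hermitian w)
  rw [div_lt_iff₀ hpos] at hk
  have h1 : (1 : ℝ) ≤ k + 1 := by linarith [k.cast_nonneg (α := ℝ)]
  have := hle (k + 1)
  push_cast at this
  nlinarith [neg_abs_le q, neg_abs_le r, abs_nonneg q, abs_nonneg r,
    mul_le_mul_of_nonneg_left (neg_abs_le r) (zero_le_one.trans h1),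
    mul_le_mul_of_nonneg_right h1 (abs_nonneg q), mul_pos (zero_lt_one.trans_le h1) hpos,
    mul_lt_mul_of_pos_left hk (zero_lt_one.trans_le h1)]

end IsParabolicAt

end Mobius

/-! ### Reduced words and Nielsen cancellation -/

namespace FreeGroup

variable {α : Type*}

/-- The inverse of a letter. -/
abbrev letterInv (x : α × Bool) : α × Bool := (x.1, !x.2)

lemma letterInv_letterInv (x : α × Bool) : letterInv (letterInv x) = x :=
  Prod.ext rfl (Bool.not_not _)

lemma not_cancel_iff {x y : α × Bool} : (x.1 = y.1 → x.2 = y.2) ↔ y ≠ letterInv x := by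
  obtain ⟨x, b⟩ := x
  obtain ⟨y, c⟩ := y
  cases b <;> cases c <;> simp [eq_comm]

lemma isReduced_append_iff {L M : List (α × Bool)} :
    IsReduced (L ++ M) ↔ IsReduced L ∧ IsReduced M ∧
      ∀ x ∈ L.getLast?, ∀ y ∈ M.head?, y ≠ letterInv x := by
  simp only [IsReduced, List.isChain_append, not_cancel_iff]

lemma isCyclicallyReduced_iff_append_self {L : List (α × Bool)} :
    IsCyclicallyReduced L ↔ IsReduced (L ++ L) := by
  simp only [isReduced_append_iff, isCyclicallyReduced_iff, not_cancel_iff]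
  tauto

lemma head?_invRev (L : List (α × Bool)) : (invRev L).head? = L.getLast?.map letterInv := by
  simp [invRev]

lemma getLast?_invRev (L : List (α × Bool)) : (invRev L).getLast? = L.head?.map letterInv := by
  simp [invRev]

lemma IsReduced.invRev {L : List (α × Bool)} (h : IsReduced L) : IsReduced (invRev L) := by
  classical
  rw [isReduced_iff_reduce_eq, reduce_invRev, h.reduce_eq]

lemma IsCyclicallyReduced.invRev {L : List (α × Bool)} (h : IsCyclicallyReduced L) :
    IsCyclicallyReduced (invRev L) := by
  rw [isCyclicallyReduced_iff_append_self] at *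
  simpa [invRev_append] using h.invRev

lemma IsCyclicallyReduced.rotate {x : α × Bool} {L : List (α × Bool)}
    (h : IsCyclicallyReduced (x :: L)) : IsCyclicallyReduced (L ++ [x]) := by
  rw [isCyclicallyReduced_iff_append_self] at *
  -- The square of a rotation is an infix of the cube of the word.
  have h1 : IsReduced ((x :: L) ++ (x :: L) ++ (x :: L)) :=
    IsReduced.append_overlap h h (List.cons_ne_nil _ _)
  exact h1.infix ⟨[x], L, by simp⟩

lemma eq_of_mk_eq_mk {L M : List (α × Bool)} (hL : IsReduced L) (hM : IsReduced M)
    (h : mk L = mk M) : L = M := by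
  classical
  simpa [toWord_mk, hL.reduce_eq, hM.reduce_eq] using congrArg toWord h

lemma norm_mk_of_isReduced [DecidableEq α] {L : List (α × Bool)} (hL : IsReduced L) :
    norm (mk L) = L.length := by
  rw [norm, toWord_mk, hL.reduce_eq]

section Nielsen

variable {ι : Type*} {f : FreeGroup ι →* FreeGroup α} {a m : ι × Bool → List (α × Bool)}

/-- If the images of the letters have cores `m e` which survive in all products of two letters,
then the core of the first letter of a reduced word survives in the image of that word. -/
lemma exists_map_mk_cons
    (hf : ∀ e, f (mk [e]) = mk (a e ++ m e ++ invRev (a (letterInv e))))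
    (hm : ∀ e, m e ≠ []) (ha : ∀ e, IsReduced (m e ++ invRev (a (letterInv e))))
    (hJ : ∀ e e', e' ≠ letterInv e → ∃ J, mk J = (mk (a (letterInv e)))⁻¹ * mk (a e') ∧
      IsReduced (m e ++ J ++ m e')) (l : List (ι × Bool)) (e : ι × Bool)
    (hl : IsReduced (e :: l)) : ∃ R, f (mk (e :: l)) = mk (a e ++ m e ++ R) ∧
      IsReduced (m e ++ R) ∧ (l ≠ [] → R ≠ []) := by
  induction l generalizing e with
  | nil => exact ⟨_, hf e, ha e, by simp⟩
  | cons e' l ih =>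
    rw [isReduced_cons_cons, not_cancel_iff] at hl
    obtain ⟨R, hR, hred, -⟩ := ih e' hl.2
    obtain ⟨J, hJ, hJred⟩ := hJ e e' hl.1
    refine ⟨J ++ m e' ++ R, ?_, ?_, by simp [hm]⟩
    · rw [← List.singleton_append, ← mul_mk, _root_.map_mul, hR, hf]
      simp only [← mul_mk, ← inv_mk, hJ, mul_assoc]
    · simpa using IsReduced.append_overlap hJred hred (hm e')

/-- The image of a word with at least two letters has reduced form `a e ++ m e ++ R` with `m e` and
`R` nonempty, so its length is at least two. -/
lemma exists_map_mk_singleton_eq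
    (hf : ∀ e, f (mk [e]) = mk (a e ++ m e ++ invRev (a (letterInv e))))
    (hm : ∀ e, m e ≠ []) (ha : ∀ e, IsReduced (m e ++ invRev (a (letterInv e))))
    (ha' : ∀ e, IsReduced (a e ++ m e))
    (hJ : ∀ e e', e' ≠ letterInv e → ∃ J, mk J = (mk (a (letterInv e)))⁻¹ * mk (a e') ∧
      IsReduced (m e ++ J ++ m e')) {x : α × Bool} (hx : mk [x] ∈ f.range) :
    ∃ e, f (mk [e]) = mk [x] := by
  classical
  obtain ⟨g, hg⟩ := hx
  have hgred : IsReduced g.toWord := isReduced_toWord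
  rw [← mk_toWord (x := g)] at hg
  match g.toWord, hgred, hg with
  | [], _, hg =>
    rw [← one_eq_mk, _root_.map_one, one_eq_mk] at hg
    exact absurd (eq_of_mk_eq_mk .nil .singleton hg) (by simp)
  | [e], _, hg => exact ⟨e, hg⟩
  | e :: e' :: l, hred, hg =>
    obtain ⟨R, hR, hRred, hR0⟩ := exists_map_mk_cons hf hm ha hJ (e' :: l) e hred
    have h := eq_of_mk_eq_mk (IsReduced.append_overlap (ha' e) hRred (hm e)) .singleton
      (hR.symm.trans hg)
    have h1 := List.length_pos_iff.2 (hm e)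
    have h2 := List.length_pos_iff.2 (hR0 (by simp))
    have := congrArg List.length h
    simp only [List.length_append, List.length_singleton] at this
    omega

end Nielsen

/-- A letter which lies in the subgroup generated by two elements with surviving cores `w₀`, `w₁`
is one of these elements or their inverses. -/
lemma letter_mem_of_mem_closure {p₀ w₀ q₀ p₁ w₁ q₁ : List (α × Bool)} (hw₀ : w₀ ≠ [])
    (hw₁ : w₁ ≠ []) (h₀ : IsReduced (p₀ ++ w₀ ++ invRev q₀))
    (h₁ : IsReduced (p₁ ++ w₁ ++ invRev q₁))
    (h₀₀ : ∃ J, mk J = (mk q₀)⁻¹ * mk p₀ ∧ IsReduced (w₀ ++ J ++ w₀))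
    (h₁₁ : ∃ J, mk J = (mk q₁)⁻¹ * mk p₁ ∧ IsReduced (w₁ ++ J ++ w₁))
    (h₀₁ : ∃ J, mk J = (mk q₀)⁻¹ * mk p₁ ∧ IsReduced (w₀ ++ J ++ w₁))
    (h₁₀ : ∃ J, mk J = (mk q₁)⁻¹ * mk p₀ ∧ IsReduced (w₁ ++ J ++ w₀))
    (hq : ∃ J, mk J = (mk q₀)⁻¹ * mk q₁ ∧ IsReduced (w₀ ++ J ++ invRev w₁))
    (hp : ∃ J, mk J = (mk p₀)⁻¹ * mk p₁ ∧ IsReduced (invRev w₀ ++ J ++ w₁))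
    {x : α × Bool} {σ τ : FreeGroup α} (hσ : σ = mk (p₀ ++ w₀ ++ invRev q₀))
    (hτ : τ = mk (p₁ ++ w₁ ++ invRev q₁)) (hx : mk [x] ∈ Subgroup.closure {σ, τ}) :
    mk [x] = σ ∨ mk [x] = σ⁻¹ ∨ mk [x] = τ ∨ mk [x] = τ⁻¹ := by
  let f : FreeGroup Bool →* FreeGroup α := lift fun b ↦ cond b σ τ
  let a : Bool × Bool → List (α × Bool) := fun e ↦
    cond e.1 (cond e.2 p₀ q₀) (cond e.2 p₁ q₁)
  let m : Bool × Bool → List (α × Bool) := fun e ↦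
    cond e.1 (cond e.2 w₀ (invRev w₀)) (cond e.2 w₁ (invRev w₁))
  -- Of the sixteen pairs of letters four cancel; inversion matches the other twelve in pairs, which
  -- leaves the six hypotheses.
  have flip {p q w w' : List (α × Bool)}
      (h : ∃ J, mk J = (mk p)⁻¹ * mk q ∧ IsReduced (w ++ J ++ w')) :
      ∃ J, mk J = (mk q)⁻¹ * mk p ∧ IsReduced (invRev w' ++ J ++ invRev w) := by
    obtain ⟨J, hJ, hred⟩ := h
    refine ⟨invRev J, by rw [← inv_mk, hJ]; group, ?_⟩
    simpa [invRev_append] using hred.invRev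
  have hrange : Subgroup.closure {σ, τ} = f.range := by
    rw [range_lift_eq_closure]
    congr 1
    ext y
    simp [eq_comm, or_comm]
  have hinv₀ : IsReduced (q₀ ++ invRev w₀ ++ invRev p₀) := by
    simpa [invRev_append] using h₀.invRev
  have hinv₁ : IsReduced (q₁ ++ invRev w₁ ++ invRev p₁) := by
    simpa [invRev_append] using h₁.invRev
  rw [hrange] at hx
  obtain ⟨⟨b, c⟩, he⟩ := exists_map_mk_singleton_eq (f := f) (a := a) (m := m)
    (by
      rintro ⟨_ | _, _ | _⟩ <;>
        simp [f, a, m, hσ, hτ, invRev_append, inv_mk])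
    (by
      rintro ⟨_ | _, _ | _⟩ <;> simp [m, hw₀, hw₁, invRev])
    (by
      rintro ⟨_ | _, _ | _⟩
      · exact hinv₁.infix ⟨q₁, [], by simp [m, a]⟩
      · exact h₁.infix ⟨p₁, [], by simp [m, a]⟩
      · exact hinv₀.infix ⟨q₀, [], by simp [m, a]⟩
      · exact h₀.infix ⟨p₀, [], by simp [m, a]⟩)
    (by
      rintro ⟨_ | _, _ | _⟩
      · exact hinv₁.infix ⟨[], invRev p₁, by simp [m, a]⟩
      · exact h₁.infix ⟨[], invRev q₁, by simp [m, a]⟩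
      · exact hinv₀.infix ⟨[], invRev p₀, by simp [m, a]⟩
      · exact h₀.infix ⟨[], invRev q₀, by simp [m, a]⟩)
    (by
      rintro ⟨_ | _, _ | _⟩ ⟨_ | _, _ | _⟩ h
      · exact flip h₁₁
      · exact absurd rfl h
      · exact flip h₀₁
      · simpa [a, m] using flip hp
      · exact absurd rfl h
      · exact h₁₁
      · simpa [a, m] using flip hq
      · exact h₁₀
      · exact flip h₁₀
      · exact hp
      · exact flip h₀₀
      · exact absurd rfl h
      · exact hq
      · exact h₀₁
      · exact absurd rfl h
      · exact h₀₀) hx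
  cases b <;> cases c <;> simp [f] at he <;> simp [← he]

/-- The case of two axes which do not overlap in an edge. -/
lemma letter_mem_of_head_ne {s v t : List (α × Bool)} (hs : IsCyclicallyReduced s) (hs0 : s ≠ [])
    (ht : IsCyclicallyReduced t) (ht0 : t ≠ []) (hvt : IsReduced (v ++ t ++ invRev v))
    (h₁ : ∀ y ∈ (v ++ t).head?, y ∉ s.head? ∧ ∀ z ∈ s.getLast?, y ≠ letterInv z)
    (h₂ : ∀ y ∈ (v ++ invRev t).head?, y ∉ s.head? ∧ ∀ z ∈ s.getLast?, y ≠ letterInv z)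
    {x : α × Bool} {σ τ : FreeGroup α} (hσ : σ = mk s) (hτ : τ = mk (v ++ t ++ invRev v))
    (hx : mk [x] ∈ Subgroup.closure {σ, τ}) :
    mk [x] = σ ∨ mk [x] = σ⁻¹ ∨ mk [x] = τ ∨ mk [x] = τ⁻¹ := by
  have hvt' : IsReduced (v ++ invRev t ++ invRev v) := by
    simpa [invRev_append] using hvt.invRev
  have k₁ : IsReduced (v ++ t) := hvt.infix ⟨[], invRev v, by simp⟩
  have k₂ : IsReduced (v ++ invRev t) := hvt'.infix ⟨[], invRev v, by simp⟩
  have left {M : List (α × Bool)} (hM : IsReduced M)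
      (h : ∀ y ∈ M.head?, y ∉ s.head? ∧ ∀ z ∈ s.getLast?, y ≠ letterInv z) :
      IsReduced (s ++ M) ∧ IsReduced (invRev s ++ M) := by
    refine ⟨isReduced_append_iff.2 ⟨hs.isReduced, hM, fun z hz y hy ↦ (h y hy).2 z hz⟩,
      isReduced_append_iff.2 ⟨hs.isReduced.invRev, hM, fun z hz y hy ↦ ?_⟩⟩
    rw [getLast?_invRev, Option.mem_map] at hz
    obtain ⟨w, hw, rfl⟩ := hz
    rintro rfl
    exact (h _ hy).1 (by rwa [letterInv_letterInv])
  have c₁ := left k₁ h₁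
  have c₂ := left k₂ h₂
  -- The word `v` is the path from the axis of `σ` to that of `τ`. All of `s` and `t` survives; only
  -- `v` cancels.
  refine letter_mem_of_mem_closure (p₀ := []) (q₀ := []) (w₀ := s) (p₁ := v) (q₁ := v) (w₁ := t)
    hs0 ht0 (by simpa using hs.isReduced) hvt ⟨[], by simp [← one_eq_mk], ?_⟩
    ⟨[], by rw [inv_mul_cancel, one_eq_mk], ?_⟩ ⟨v, by simp [← one_eq_mk], ?_⟩
    ⟨invRev v, by simp [← one_eq_mk, inv_mk], ?_⟩ ⟨v, by simp [← one_eq_mk], ?_⟩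
    ⟨v, by simp [← one_eq_mk], ?_⟩ (by simpa using hσ) hτ hx
  · simpa using isCyclicallyReduced_iff_append_self.1 hs
  · simpa using isCyclicallyReduced_iff_append_self.1 ht
  · simpa using c₁.1
  · simpa [invRev_append] using c₂.2.invRev
  · simpa using c₂.1
  · simpa using c₁.2

/-- The case of two axes which overlap in exactly one edge. -/
lemma letter_mem_of_head_eq {x : α × Bool} {s t : List (α × Bool)}
    (hs : IsCyclicallyReduced (x :: s)) (ht : IsCyclicallyReduced (x :: t)) (hs0 : s ≠ [])
    (ht0 : t ≠ []) (hhead : s.head? ≠ t.head?) (hlast : s.getLast? ≠ t.getLast?)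
    {y : α × Bool} {σ τ : FreeGroup α} (hσ : σ = mk (x :: s)) (hτ : τ = mk (x :: t))
    (hy : mk [y] ∈ Subgroup.closure {σ, τ}) :
    mk [y] = σ ∨ mk [y] = σ⁻¹ ∨ mk [y] = τ ∨ mk [y] = τ⁻¹ := by
  have hsr : IsReduced s := hs.isReduced.infix ⟨[x], [], by simp⟩
  have htr : IsReduced t := ht.isReduced.infix ⟨[x], [], by simp⟩
  have hsx : IsReduced (s ++ [x]) := hs.rotate.isReduced
  have htx : IsReduced (t ++ [x]) := ht.rotate.isReduced
  -- The common edge `x` is all that cancels in `σ⁻¹ τ`, because `s` and `t` begin differently;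
  -- nothing cancels in `σ τ⁻¹`, because they end differently.
  refine letter_mem_of_mem_closure (p₀ := [x]) (q₀ := []) (w₀ := s) (p₁ := [x]) (q₁ := []) (w₁ := t)
    hs0 ht0 (by simpa using hs.isReduced) (by simpa using ht.isReduced)
    ⟨[x], by simp [← one_eq_mk], ?_⟩
    ⟨[x], by simp [← one_eq_mk], ?_⟩ ⟨[x], by simp [← one_eq_mk], ?_⟩
    ⟨[x], by simp [← one_eq_mk], ?_⟩ ⟨[], by simp [← one_eq_mk], ?_⟩
    ⟨[], by rw [inv_mul_cancel, one_eq_mk], ?_⟩ (by simpa using hσ) (by simpa using hτ) hy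
  · exact IsReduced.append_overlap hsx hs.isReduced (by simp)
  · exact IsReduced.append_overlap htx ht.isReduced (by simp)
  · exact IsReduced.append_overlap hsx ht.isReduced (by simp)
  · exact IsReduced.append_overlap htx hs.isReduced (by simp)
  · rw [List.append_nil, isReduced_append_iff]
    refine ⟨hsr, htr.invRev, fun z hz y hy e ↦ hlast ?_⟩
    rw [head?_invRev, Option.mem_map] at hy
    obtain ⟨w, hw, rfl⟩ := hy
    rw [Option.mem_def.1 hz, Option.mem_def.1 hw]
    simpa [Prod.ext_iff, eq_comm] using e
  · rw [List.append_nil, isReduced_append_iff]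
    refine ⟨hsr.invRev, htr, fun z hz y hy e ↦ hhead ?_⟩
    rw [getLast?_invRev, Option.mem_map] at hz
    obtain ⟨w, hw, rfl⟩ := hz
    rw [Option.mem_def.1 hw, Option.mem_def.1 hy, e, letterInv_letterInv]

end FreeGroup

/-! ### Swaps and inversions of pairs -/

namespace IsSwapInvOf

variable {Γ Δ : Type*} [Group Γ] [Group Δ]

lemma map (f : Γ →* Δ) {p q : Γ × Γ} (h : IsSwapInvOf p q) :
    IsSwapInvOf (f p.1, f p.2) (f q.1, f q.2) := by
  obtain ⟨x, y, hx, hy, hq⟩ := h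
  refine ⟨f x, f y, ?_, ?_, ?_⟩
  · rcases hx with rfl | rfl <;> simp
  · rcases hy with rfl | rfl <;> simp
  · rcases hq with rfl | rfl <;> simp

lemma of_inv_left {a b : Γ} {q : Γ × Γ} (h : IsSwapInvOf (a⁻¹, b) q) : IsSwapInvOf (a, b) q := by
  obtain ⟨x, y, hx, hy, hq⟩ := h
  exact ⟨x, y, by simpa [or_comm] using hx, hy, hq⟩

lemma of_swap {a b : Γ} {q : Γ × Γ} (h : IsSwapInvOf (b, a) q) : IsSwapInvOf (a, b) q := by
  obtain ⟨x, y, hx, hy, hq⟩ := h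
  exact ⟨y, x, hy, hx, hq.symm⟩

end IsSwapInvOf

/-! ### Generating pairs with transverse axes -/

namespace FreeGroup

/-- Up to conjugation, exchanging entries and replacing them by inverses, the pair `(σ, τ)` is the
pair of free generators `(a, b)` or the pair `(a, ab)`. -/
def IsStandardPair (σ τ : FreeGroup (Fin 2)) : Prop :=
  ∃ a b σ' τ' h : FreeGroup (Fin 2), IsSwapInvOf (of 0, of 1) (a, b) ∧
    IsSwapInvOf (σ, τ) (σ', τ') ∧ h * σ' * h⁻¹ = a ∧ (h * τ' * h⁻¹ = b ∨ h * τ' * h⁻¹ = a * b)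

lemma IsStandardPair.of_inv_left {σ τ : FreeGroup (Fin 2)} (h : IsStandardPair σ⁻¹ τ) :
    IsStandardPair σ τ := by
  obtain ⟨a, b, σ', τ', g, h₁, h₂, h₃⟩ := h
  exact ⟨a, b, σ', τ', g, h₁, h₂.of_inv_left, h₃⟩

lemma IsStandardPair.of_swap {σ τ : FreeGroup (Fin 2)} (h : IsStandardPair τ σ) :
    IsStandardPair σ τ := by
  obtain ⟨a, b, σ', τ', g, h₁, h₂, h₃⟩ := h
  exact ⟨a, b, σ', τ', g, h₁, h₂.of_swap, h₃⟩

lemma IsStandardPair.of_conj {σ τ : FreeGroup (Fin 2)} (u : FreeGroup (Fin 2))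
    (h : IsStandardPair (u * σ * u⁻¹) (u * τ * u⁻¹)) : IsStandardPair σ τ := by
  obtain ⟨a, b, σ', τ', g, h₁, h₂, h₃, h₄⟩ := h
  have hc (x : FreeGroup (Fin 2)) : g * u * (u⁻¹ * x * u) * (g * u)⁻¹ = g * x * g⁻¹ := by group
  refine ⟨a, b, u⁻¹ * σ' * u, u⁻¹ * τ' * u, g * u, h₁, ?_, by rw [hc, h₃], by rwa [hc]⟩
  simpa [MulAut.conj_apply, mul_assoc] using h₂.map (MulAut.conj u⁻¹).toMonoidHom

variable {α : Type*}

/-- The axes of `σ` and `τ` in the Cayley tree do not have two consecutive edges in common on which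
`σ` and `τ` translate in the same direction. -/
def NoCommonTurn (σ τ : FreeGroup α) : Prop :=
  ∀ (u : FreeGroup α) (s t : List (α × Bool)), IsCyclicallyReduced s → IsCyclicallyReduced t →
    s ≠ [] → t ≠ [] → u * σ * u⁻¹ = mk s → u * τ * u⁻¹ = mk t → s.head? = t.head? →
    s.getLast? ≠ t.getLast?

lemma NoCommonTurn.symm {σ τ : FreeGroup α} (h : NoCommonTurn σ τ) : NoCommonTurn τ σ :=
  fun u s t hs ht hs0 ht0 es et h₁ h₂ ↦ h u t s ht hs ht0 hs0 et es h₁.symm h₂.symm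

lemma invRev_ne_nil {L : List (α × Bool)} (h : L ≠ []) : invRev L ≠ [] := by
  simpa [invRev] using h

lemma NoCommonTurn.inv_inv {σ τ : FreeGroup α} (h : NoCommonTurn σ τ) :
    NoCommonTurn σ⁻¹ τ⁻¹ := by
  intro u s t hs ht hs0 ht0 es et h₁ h₂
  refine h u (invRev s) (invRev t) hs.invRev ht.invRev (invRev_ne_nil hs0) (invRev_ne_nil ht0)
    ?_ ?_ ?_ ?_
  · rw [← inv_mk, ← es]; group
  · rw [← inv_mk, ← et]; group
  · rw [head?_invRev, head?_invRev, h₂]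
  · rw [getLast?_invRev, getLast?_invRev, h₁]

lemma NoCommonTurn.conj {σ τ : FreeGroup α} (h : NoCommonTurn σ τ) (u : FreeGroup α) :
    NoCommonTurn (u * σ * u⁻¹) (u * τ * u⁻¹) := by
  intro g s t hs ht hs0 ht0 es et
  refine h (g * u) s t hs ht hs0 ht0 ?_ ?_
  · rw [← es]; group
  · rw [← et]; group

/-- A pair of generators of a free group whose axes do not have two consecutive edges in common. -/
structure IsTransversePair (σ τ : FreeGroup α) : Prop where
  closure_eq_top : Subgroup.closure {σ, τ} = ⊤
  left_ne_one : σ ≠ 1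
  right_ne_one : τ ≠ 1
  noCommonTurn : NoCommonTurn σ τ
  noCommonTurn_inv : NoCommonTurn σ τ⁻¹

namespace IsTransversePair

variable {σ τ : FreeGroup α}

lemma symm (h : IsTransversePair σ τ) : IsTransversePair τ σ where
  closure_eq_top := by rw [Set.pair_comm, h.closure_eq_top]
  left_ne_one := h.right_ne_one
  right_ne_one := h.left_ne_one
  noCommonTurn := h.noCommonTurn.symm
  noCommonTurn_inv := by simpa using h.noCommonTurn_inv.symm.inv_inv

lemma inv_left (h : IsTransversePair σ τ) : IsTransversePair σ⁻¹ τ where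
  closure_eq_top := by
    rw [eq_top_iff, ← h.closure_eq_top, Subgroup.closure_le, Set.insert_subset_iff,
      Set.singleton_subset_iff]
    exact ⟨by simpa using inv_mem (Subgroup.subset_closure (Set.mem_insert σ⁻¹ {τ})),
      Subgroup.subset_closure (by simp)⟩
  left_ne_one := inv_ne_one.2 h.left_ne_one
  right_ne_one := h.right_ne_one
  noCommonTurn := by simpa using h.noCommonTurn_inv.inv_inv
  noCommonTurn_inv := h.noCommonTurn.inv_inv

lemma conj (h : IsTransversePair σ τ) (u : FreeGroup α) :
    IsTransversePair (u * σ * u⁻¹) (u * τ * u⁻¹) where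
  closure_eq_top := by
    rw [eq_top_iff]
    intro x _
    have hx : u⁻¹ * x * u ∈ Subgroup.closure {σ, τ} := by rw [h.closure_eq_top]; trivial
    have := Subgroup.mem_map_of_mem (MulAut.conj u).toMonoidHom hx
    rw [MonoidHom.map_closure, Set.image_pair] at this
    simpa [mul_assoc] using this
  left_ne_one := by simpa using h.left_ne_one
  right_ne_one := by simpa using h.right_ne_one
  noCommonTurn := h.noCommonTurn.conj u
  noCommonTurn_inv := by simpa [mul_assoc] using h.noCommonTurn_inv.conj u

end IsTransversePair

lemma exists_eq_conjugate_isCyclicallyReduced {L : List (α × Bool)} (hL : IsReduced L)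
    (h0 : L ≠ []) : ∃ v t, L = v ++ t ++ invRev v ∧ IsCyclicallyReduced t ∧ t ≠ [] := by
  classical
  refine ⟨_, _, (reduceCyclically.conj_conjugator_reduceCyclically L).symm,
    reduceCyclically.isCyclicallyReduced hL, fun h ↦ h0 ?_⟩
  have e := reduceCyclically.conj_conjugator_reduceCyclically L
  rw [h, List.append_nil] at e
  have : IsReduced (reduceCyclically.conjugator L ++ invRev (reduceCyclically.conjugator L)) := by
    rwa [e]
  rw [← e]
  exact eq_of_mk_eq_mk this .nil (by rw [← mul_mk, ← inv_mk, mul_inv_cancel, one_eq_mk])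

/-- Two elements of which each free generator is one, up to inversion, are the free generators. -/
lemma eq_generators {σ τ : FreeGroup (Fin 2)}
    (h : ∀ x : Fin 2 × Bool, mk [x] = σ ∨ mk [x] = σ⁻¹ ∨ mk [x] = τ ∨ mk [x] = τ⁻¹) :
    IsSwapInvOf (of 0, of 1) (σ, τ) := by
  have h0 : (of 0 : FreeGroup (Fin 2)) = σ ∨ of 0 = σ⁻¹ ∨ of 0 = τ ∨ of 0 = τ⁻¹ := h (0, true)
  have h1 : (of 1 : FreeGroup (Fin 2)) = σ ∨ of 1 = σ⁻¹ ∨ of 1 = τ ∨ of 1 = τ⁻¹ := h (1, true)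
  have n1 : (of 0 : FreeGroup (Fin 2)) ≠ of 1 := by decide
  have n2 : (of 0 : FreeGroup (Fin 2)) ≠ (of 1)⁻¹ := by decide
  have n3 : (of 0 : FreeGroup (Fin 2))⁻¹ ≠ of 1 := by decide
  generalize (of 0 : FreeGroup (Fin 2)) = a at *
  generalize (of 1 : FreeGroup (Fin 2)) = b at *
  rcases h0 with rfl | h0 | rfl | h0
  · rcases h1 with rfl | rfl | rfl | h1
    · exact absurd rfl n1
    · exact absurd rfl n3
    · exact ⟨_, _, .inl rfl, .inl rfl, .inl rfl⟩
    · exact ⟨_, _, .inl rfl, .inr (by simp [h1]), .inl rfl⟩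
  · obtain rfl := inv_eq_iff_eq_inv.2 h0
    rcases h1 with rfl | h1 | rfl | h1
    · exact absurd rfl n3
    · exact absurd (by simp [h1]) n1
    · exact ⟨_, _, .inr rfl, .inl rfl, .inl rfl⟩
    · exact ⟨_, _, .inr rfl, .inr (by simp [h1]), .inl rfl⟩
  · rcases h1 with rfl | h1 | rfl | rfl
    · exact ⟨_, _, .inl rfl, .inl rfl, .inr rfl⟩
    · exact ⟨_, _, .inl rfl, .inr (by simp [h1]), .inr rfl⟩
    · exact absurd rfl n1
    · exact absurd rfl n3
  · obtain rfl := inv_eq_iff_eq_inv.2 h0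
    rcases h1 with rfl | h1 | rfl | h1
    · exact ⟨_, _, .inr rfl, .inl rfl, .inr rfl⟩
    · exact ⟨_, _, .inr rfl, .inr (by simp [h1]), .inr rfl⟩
    · exact absurd rfl n3
    · exact absurd (by simp [h1]) n1

lemma isStandardPair_of_letter {σ τ : FreeGroup (Fin 2)}
    (h : ∀ x : Fin 2 × Bool, mk [x] = σ ∨ mk [x] = σ⁻¹ ∨ mk [x] = τ ∨ mk [x] = τ⁻¹) :
    IsStandardPair σ τ :=
  ⟨σ, τ, σ, τ, 1, eq_generators h, ⟨σ, τ, .inl rfl, .inl rfl, .inl rfl⟩, by simp, by simp⟩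

lemma mk_cons (x : α × Bool) (L : List (α × Bool)) : mk (x :: L) = mk [x] * mk L := by
  rw [mul_mk, List.singleton_append]

lemma conj_mk_cons (x : α × Bool) (L : List (α × Bool)) :
    (mk [x])⁻¹ * mk (x :: L) * ((mk [x])⁻¹)⁻¹ = mk (L ++ [x]) := by
  rw [mk_cons x L, ← mul_mk]
  group

/-- Both rotated words end in `x`, so equal first letters would be a common turn at the far end of
the edge `x`. Rotating also covers empty `s` or `t`. -/
lemma head?_append_singleton_ne {x : α × Bool} {s t : List (α × Bool)}
    (h : IsTransversePair (mk (x :: s)) (mk (x :: t))) (hs : IsCyclicallyReduced (x :: s))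
    (ht : IsCyclicallyReduced (x :: t)) : (s ++ [x]).head? ≠ (t ++ [x]).head? := fun e ↦
  h.noCommonTurn (mk [x])⁻¹ (s ++ [x]) (t ++ [x]) hs.rotate ht.rotate (by simp) (by simp)
    (conj_mk_cons x s) (conj_mk_cons x t) e (by simp)

lemma getLast?_cons_ne {x : α × Bool} {s t : List (α × Bool)}
    (h : IsTransversePair (mk (x :: s)) (mk (x :: t))) (hs : IsCyclicallyReduced (x :: s))
    (ht : IsCyclicallyReduced (x :: t)) : (x :: s).getLast? ≠ (x :: t).getLast? :=
  h.noCommonTurn 1 (x :: s) (x :: t) hs ht (by simp) (by simp) (by simp) (by simp) (by simp)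

/-- The pair `x`, `t` also generates. Transversality forbids `t` to begin or end with `x`, and
cyclic reducedness forbids `x⁻¹`, so the case of disjoint axes makes `x`, `t` the free generators
`a`, `b`. -/
lemma isStandardPair_singleton_cons {x : Fin 2 × Bool} {t : List (Fin 2 × Bool)}
    (h : IsTransversePair (mk [x]) (mk (x :: t))) (ht : IsCyclicallyReduced (x :: t)) :
    IsStandardPair (mk [x]) (mk (x :: t)) := by
  have hlast := getLast?_cons_ne h .singleton ht
  have hhead := head?_append_singleton_ne h .singleton ht
  have ht0 : t ≠ [] := by rintro rfl; simp at hlast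
  have htr : IsReduced t := ht.isReduced.infix ⟨[x], [], by simp⟩
  have hmul := mk_cons x t
  have hxt : ∀ y ∈ t.head?, y ≠ letterInv x :=
    (isReduced_append_iff (L := [x]).1 ht.isReduced).2.2 x rfl
  have htx : ∀ y ∈ t.getLast?, x ≠ letterInv y := fun y hy ↦
    (isReduced_append_iff.1 ht.rotate.isReduced).2.2 y hy x rfl
  have hgen : Subgroup.closure {mk [x], mk t} = ⊤ := by
    rw [eq_top_iff, ← h.closure_eq_top, Subgroup.closure_le, Set.insert_subset_iff,
      Set.singleton_subset_iff, hmul]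
    have hx : mk [x] ∈ Subgroup.closure {mk [x], mk t} := Subgroup.subset_closure (by simp)
    exact ⟨hx, mul_mem hx (Subgroup.subset_closure (by simp))⟩
  obtain ⟨v, w, e, hw, hw0⟩ := exists_eq_conjugate_isCyclicallyReduced htr ht0
  have key (y : Fin 2 × Bool) := letter_mem_of_head_ne (s := [x]) (σ := mk [x]) (τ := mk t) (x := y)
    .singleton (by simp) hw hw0 (by rwa [← e])
    (by
      intro y hy
      have hy' : y ∈ t.head? := by
        rw [e, List.head?_append, hy, Option.some_or]; rfl
      refine ⟨fun hyx ↦ hhead ?_, fun z hz ↦ ?_⟩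
      · rw [List.head?_append, List.head?_append, hy']
        simpa using hyx
      · obtain rfl : x = z := by simpa using hz
        exact hxt y hy')
    (by
      intro y hy
      have hy' : letterInv y ∈ t.getLast? := by
        have : y ∈ (invRev t).head? := by
          rw [e, invRev_append, invRev_append, invRev_invRev, ← List.append_assoc,
            List.head?_append, hy, Option.some_or]; rfl
        rw [head?_invRev, Option.mem_map] at this
        obtain ⟨z, hz, rfl⟩ := this
        rwa [letterInv_letterInv]
      refine ⟨fun hyx ↦ htx _ hy' ?_, fun z hz hyz ↦ hlast ?_⟩
      · rw [letterInv_letterInv]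
        simpa using hyx
      · obtain rfl : x = z := by simpa using hz
        rw [hyz, letterInv_letterInv] at hy'
        rw [← List.singleton_append (l := t), List.getLast?_append, hy']
        rfl)
    rfl (by rw [e]) (by rw [hgen]; trivial)
  exact ⟨mk [x], mk t, mk [x], mk (x :: t), 1, eq_generators key,
    ⟨_, _, .inl rfl, .inl rfl, .inl rfl⟩, by simp, .inr (by simp)⟩

lemma isStandardPair_of_head?_eq {s t : List (Fin 2 × Bool)}
    (h : IsTransversePair (mk s) (mk t)) (hs : IsCyclicallyReduced s)
    (ht : IsCyclicallyReduced t) {x : Fin 2 × Bool} (hsx : x ∈ s.head?) (htx : x ∈ t.head?) :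
    IsStandardPair (mk s) (mk t) := by
  obtain ⟨s, rfl⟩ := List.head?_eq_some_iff.1 hsx
  obtain ⟨t, rfl⟩ := List.head?_eq_some_iff.1 htx
  by_cases hs0 : s = []
  · subst hs0
    exact isStandardPair_singleton_cons h ht
  by_cases ht0 : t = []
  · subst ht0
    exact (isStandardPair_singleton_cons h.symm hs).of_swap
  have hlast := getLast?_cons_ne h hs ht
  have hhead := head?_append_singleton_ne h hs ht
  obtain ⟨y, s', rfl⟩ := List.exists_cons_of_ne_nil hs0
  obtain ⟨z, t', rfl⟩ := List.exists_cons_of_ne_nil ht0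
  rw [List.getLast?_cons_cons, List.getLast?_cons_cons] at hlast
  -- Both words have length at least two, so neither they nor their inverses can equal the letter
  -- `x`: this case is impossible.
  have key := letter_mem_of_head_eq hs ht hs0 ht0 (by simpa using hhead) hlast (y := x) rfl rfl
    (by rw [h.closure_eq_top]; trivial)
  rw [inv_mk, inv_mk] at key
  rcases key with key | key | key | key
  · simpa using eq_of_mk_eq_mk .singleton hs.isReduced key
  · simpa [invRev] using congrArg List.length (eq_of_mk_eq_mk .singleton hs.isReduced.invRev key)
  · simpa using eq_of_mk_eq_mk .singleton ht.isReduced key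
  · simpa [invRev] using congrArg List.length (eq_of_mk_eq_mk .singleton ht.isReduced.invRev key)

/-- Both axes pass through the base vertex. If they share an edge there, inverting entries makes
both words begin with it; otherwise the case of disjoint axes applies with empty connecting path. -/
lemma isStandardPair_of_isCyclicallyReduced {s t : List (Fin 2 × Bool)}
    (h : IsTransversePair (mk s) (mk t)) (hs : IsCyclicallyReduced s) (hs0 : s ≠ [])
    (ht : IsCyclicallyReduced t) (ht0 : t ≠ []) : IsStandardPair (mk s) (mk t) := by
  have hs' : IsTransversePair (mk (invRev s)) (mk t) := by simpa [inv_mk] using h.inv_left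
  have ht' : IsTransversePair (mk s) (mk (invRev t)) := by
    simpa [inv_mk] using h.symm.inv_left.symm
  have hst' : IsTransversePair (mk (invRev s)) (mk (invRev t)) := by
    simpa [inv_mk] using ht'.inv_left
  have invl {s t : List (Fin 2 × Bool)} (h : IsStandardPair (mk (invRev s)) (mk t)) :
      IsStandardPair (mk s) (mk t) := .of_inv_left (by rwa [inv_mk])
  have invr {s t : List (Fin 2 × Bool)} (h : IsStandardPair (mk s) (mk (invRev t))) :
      IsStandardPair (mk s) (mk t) := .of_swap (invl h.of_swap)
  have mem_head {L : List (Fin 2 × Bool)} {y z : Fin 2 × Bool} (hz : z ∈ L.getLast?)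
      (e : y = letterInv z) : y ∈ (invRev L).head? := by
    rw [head?_invRev, Option.mem_map]
    exact ⟨z, hz, e.symm⟩
  by_cases h₁ : ∀ y ∈ t.head?, y ∉ s.head? ∧ ∀ z ∈ s.getLast?, y ≠ letterInv z
  · by_cases h₂ : ∀ y ∈ (invRev t).head?, y ∉ s.head? ∧ ∀ z ∈ s.getLast?, y ≠ letterInv z
    · exact isStandardPair_of_letter fun x ↦ letter_mem_of_head_ne (v := []) hs hs0 ht ht0
        (by simpa [invRev] using ht.isReduced) (by simpa using h₁) (by simpa using h₂) rfl
        (by simp) (by rw [h.closure_eq_top]; trivial)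
    · push Not at h₂
      obtain ⟨y, hy, hy'⟩ := h₂
      by_cases hys : y ∈ s.head?
      · exact invr (isStandardPair_of_head?_eq ht' hs ht.invRev hys hy)
      · obtain ⟨z, hz, e⟩ := hy' hys
        exact invr (invl (isStandardPair_of_head?_eq hst' hs.invRev ht.invRev (mem_head hz e) hy))
  · push Not at h₁
    obtain ⟨y, hy, hy'⟩ := h₁
    by_cases hys : y ∈ s.head?
    · exact isStandardPair_of_head?_eq h hs ht hys hy
    · obtain ⟨z, hz, e⟩ := hy' hys
      exact invl (isStandardPair_of_head?_eq hs' hs.invRev ht (mem_head hz e) hy)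

lemma norm_mk_conj_lt {y : α × Bool} [DecidableEq α] {L : List (α × Bool)}
    (h : IsReduced (y :: L ++ invRev [y])) :
    norm ((mk [y])⁻¹ * mk (y :: L ++ invRev [y]) * ((mk [y])⁻¹)⁻¹) <
      norm (mk (y :: L ++ invRev [y])) := by
  have e : (mk [y])⁻¹ * mk (y :: L ++ invRev [y]) * ((mk [y])⁻¹)⁻¹ = mk L := by
    rw [← mul_mk, mk_cons y L, ← inv_mk]
    group
  have hL : IsReduced L := h.infix ⟨[y], invRev [y], by simp⟩
  rw [e, norm_mk_of_isReduced h, norm_mk_of_isReduced hL]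
  simp

/-- Two generators of a free group of rank two whose axes do not overlap in two consecutive edges
are, up to the obvious changes, free generators `a`, `b` or `a`, `ab`. -/
theorem isStandardPair_of_isTransversePair {σ τ : FreeGroup (Fin 2)} (h : IsTransversePair σ τ) :
    IsStandardPair σ τ := by
  -- Minimising over `u` moves the base vertex to a point of the axis of `σ` nearest to the axis of
  -- `τ`.
  let P (k : ℕ) : Prop := ∃ u s, IsCyclicallyReduced s ∧ u * σ * u⁻¹ = mk s ∧
    norm (u * τ * u⁻¹) = k
  have hP : ∃ k, P k := by
    obtain ⟨v, t, e, ht, -⟩ := exists_eq_conjugate_isCyclicallyReduced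
      (isReduced_toWord (x := σ)) (mt toWord_eq_nil_iff.1 h.left_ne_one)
    refine ⟨_, (mk v)⁻¹, t, ht, ?_, rfl⟩
    rw [← mk_toWord (x := σ), e, ← mul_mk, ← mul_mk, ← inv_mk]
    group
  classical
  obtain ⟨u, s, hs, es, en⟩ := Nat.find_spec hP
  have hmin (g : FreeGroup (Fin 2)) (s' : List (Fin 2 × Bool)) (hs' : IsCyclicallyReduced s')
      (eg : g * (u * σ * u⁻¹) * g⁻¹ = mk s') :
      norm (u * τ * u⁻¹) ≤ norm (g * (u * τ * u⁻¹) * g⁻¹) := by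
    rw [en]
    refine Nat.find_min' hP ⟨g * u, s', hs', ?_, ?_⟩
    · rw [← eg]; group
    · congr 1; group
  refine IsStandardPair.of_conj u ?_
  replace h := h.conj u
  rw [es] at h hmin ⊢
  clear en es
  generalize u * τ * u⁻¹ = τ at *
  have hs0 : s ≠ [] := by
    rintro rfl
    exact h.left_ne_one one_eq_mk.symm
  obtain ⟨v, t, e, ht, ht0⟩ := exists_eq_conjugate_isCyclicallyReduced
    (isReduced_toWord (x := τ)) (mt toWord_eq_nil_iff.1 h.right_ne_one)
  have hred : IsReduced (v ++ t ++ invRev v) := e ▸ isReduced_toWord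
  obtain rfl : mk (v ++ t ++ invRev v) = τ := by rw [← e, mk_toWord]
  clear e
  cases v with
  | nil =>
    have e : mk ([] ++ t ++ invRev []) = mk t := by simp
    rw [e] at h ⊢
    exact isStandardPair_of_isCyclicallyReduced h hs hs0 ht ht0
  | cons y v =>
    have e : y :: v ++ t ++ invRev (y :: v) = y :: (v ++ t ++ invRev v) ++ invRev [y] := by
      rw [← List.singleton_append (l := v), invRev_append]
      simp
    have hlt := norm_mk_conj_lt (e ▸ hred)
    rw [← e] at hlt
    -- If the path to the axis of `τ` started along the axis of `σ`, in either direction, rotating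
    -- `s` or its inverse would keep it cyclically reduced and shorten `τ`.
    have hy₁ : y ∉ s.head? := by
      intro hy
      obtain ⟨s, rfl⟩ := List.head?_eq_some_iff.1 hy
      exact (hmin _ _ hs.rotate (conj_mk_cons y s)).not_gt hlt
    have hy₂ : ∀ z ∈ s.getLast?, y ≠ letterInv z := by
      rintro z hz rfl
      have hy : letterInv z ∈ (invRev s).head? := by
        rw [head?_invRev, Option.mem_map]
        exact ⟨z, hz, rfl⟩
      obtain ⟨r, hr⟩ := List.head?_eq_some_iff.1 hy
      have hrot := (hr ▸ hs.invRev : IsCyclicallyReduced (letterInv z :: r)).rotate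
      refine (hmin _ _ hrot.invRev ?_).not_gt hlt
      rw [← inv_mk, ← conj_mk_cons, ← hr, ← inv_mk]
      group
    refine isStandardPair_of_letter fun x ↦ letter_mem_of_head_ne (v := y :: v) hs hs0 ht ht0 hred
      ?_ ?_ rfl rfl (by rw [h.closure_eq_top]; trivial)
    · intro x hx
      obtain rfl : y = x := by simpa using hx
      exact ⟨hy₁, hy₂⟩
    · intro x hx
      obtain rfl : y = x := by simpa using hx
      exact ⟨hy₁, hy₂⟩

end FreeGroup

/-! ### Ping-pong on the closed discs -/

open FreeGroup

/-- The circle of a configuration whose interior is the target of a letter of the free group. -/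
def letterCircle (C C' : Fin 2 → OrientedCircle) (x : Fin 2 × Bool) : OrientedCircle :=
  cond x.2 (C' x.1) (C x.1)

/-- Supplies the third disc, both as a source of base points and to separate two tangent discs. -/
lemma exists_ne_letter : ∀ x y : Fin 2 × Bool, ∃ z, x ≠ z ∧ y ≠ z := by
  decide

namespace IsClassicalTSchottkyConfiguration

variable {C C' : Fin 2 → OrientedCircle} {g : Fin 2 → Mobius}

lemma disjoint_letterCircle (h : IsClassicalTSchottkyConfiguration C C' g) {x y : Fin 2 × Bool}
    (hxy : x ≠ y) : Disjoint (letterCircle C C' x).interior (letterCircle C C' y).interior := by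
  obtain ⟨i, _ | _⟩ := x <;> obtain ⟨j, _ | _⟩ := y
  · exact h.disjoint_interiors (i := .inl i) (j := .inl j) (by simpa using hxy)
  · exact h.disjoint_interiors (i := .inl i) (j := .inr j) (by simp)
  · exact h.disjoint_interiors (i := .inr i) (j := .inl j) (by simp)
  · exact h.disjoint_interiors (i := .inr i) (j := .inr j) (by simpa using hxy)

lemma notMem_interior (h : IsClassicalTSchottkyConfiguration C C' g) {x y : Fin 2 × Bool}
    (hxy : x ≠ y) {z : OnePoint ℂ} (hz : z ∉ (letterCircle C C' x).exterior) :
    z ∉ (letterCircle C C' y).interior := fun hz' ↦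
  hz (OrientedCircle.interior_subset_exterior (h.disjoint_letterCircle hxy) hz')

/-- One move of ping-pong. The target is a closed disc, since a boundary point may lie on two
tangent circles. -/
lemma letter_smul_notMem_exterior (h : IsClassicalTSchottkyConfiguration C C' g)
    {x : Fin 2 × Bool} {z : OnePoint ℂ}
    (hz : z ∉ (letterCircle C C' (letterInv x)).interior) :
    lift g (FreeGroup.mk [x]) • z ∉ (letterCircle C C' x).exterior := by
  obtain ⟨i, _ | _⟩ := x
  · intro hz'
    refine hz ?_
    have := Set.mem_image_of_mem (fun z ↦ g i • z) hz'
    simpa [lift_mk, letterCircle, h.image_exterior i] using this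
  · intro hz'
    exact hz ((OrientedCircle.smul_mem_exterior_iff (h.image_exterior i)).1
      (by simpa [lift_mk, letterCircle] using hz'))

lemma word_smul_notMem_exterior (h : IsClassicalTSchottkyConfiguration C C' g)
    (l : List (Fin 2 × Bool)) {x : Fin 2 × Bool} (hl : IsReduced (x :: l)) {z : OnePoint ℂ}
    (hz : ∀ e ∈ (x :: l).getLast?, z ∉ (letterCircle C C' (letterInv e)).interior) :
    lift g (FreeGroup.mk (x :: l)) • z ∉ (letterCircle C C' x).exterior := by
  induction l generalizing x with
  | nil => exact h.letter_smul_notMem_exterior (hz x rfl)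
  | cons y l ih =>
    rw [isReduced_cons_cons, not_cancel_iff] at hl
    rw [mk_cons, _root_.map_mul, mul_smul]
    rw [List.getLast?_cons_cons] at hz
    exact h.letter_smul_notMem_exterior (h.notMem_interior hl.1 (ih hl.2 hz))

/-- A classical T-Schottky group of rank two is free on its marked generators. -/
lemma lift_injective (h : IsClassicalTSchottkyConfiguration C C' g) :
    Function.Injective (lift g) := by
  rw [injective_iff_map_eq_one]
  intro w hw
  by_contra hw1
  obtain ⟨x, l, e⟩ := List.exists_cons_of_ne_nil (mt toWord_eq_nil_iff.1 hw1)
  have hred : IsReduced (x :: l) := e ▸ isReduced_toWord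
  obtain ⟨y, hy⟩ : ∃ y, (x :: l).getLast? = some y :=
    ⟨_, List.getLast?_eq_some_getLast (List.cons_ne_nil x l)⟩
  -- A point of the disc of `t` may enter the game, and it ends in the closed disc of `x`, which
  -- misses the disc of `t`; so `w` moves it.
  obtain ⟨t, htx, hty⟩ := exists_ne_letter x (letterInv y)
  obtain ⟨z, hz⟩ := (letterCircle C C' t).interior_nonempty
  refine h.word_smul_notMem_exterior l hred (z := z) ?_ ?_
  · intro e he
    obtain rfl : y = e := Option.some_injective _ (hy.symm.trans he)
    exact h.notMem_interior hty.symm (OrientedCircle.notMem_exterior_of_mem_interior hz)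
  · rw [← e, mk_toWord, hw, one_smul]
    exact OrientedCircle.interior_subset_exterior (h.disjoint_letterCircle htx) hz

/-- As `w` is cyclically reduced, its powers keep the disc of its first letter inside the closed
disc, which therefore contains the parabolic fixed point. -/
lemma fixedPoint_notMem_exterior (h : IsClassicalTSchottkyConfiguration C C' g)
    {w : List (Fin 2 × Bool)} (hw : IsCyclicallyReduced w) {p : OnePoint ℂ}
    (hp : (lift g (FreeGroup.mk w)).IsParabolicAt p) {x : Fin 2 × Bool} (hx : x ∈ w.head?) :
    p ∉ (letterCircle C C' x).exterior := by
  obtain ⟨l, rfl⟩ := List.head?_eq_some_iff.1 hx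
  obtain ⟨z, hz⟩ := (letterCircle C C' x).interior_nonempty
  refine hp.notMem_exterior_of_forall_pow (z := z) fun k ↦ ?_
  induction k with
  | zero =>
    rw [pow_zero, one_smul]
    exact OrientedCircle.notMem_exterior_of_mem_interior hz
  | succ k ih =>
    rw [pow_succ', mul_smul]
    refine h.word_smul_notMem_exterior l hw.isReduced fun e he ↦ h.notMem_interior ?_ ih
    exact not_cancel_iff.1 (hw.2 e he x rfl)

/-- At a common turn both fixed points would lie in the closed discs of the first letter and of the
inverse last letter, which meet in at most one point. -/
lemma noCommonTurn (h : IsClassicalTSchottkyConfiguration C C' g) {σ τ : FreeGroup (Fin 2)}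
    {p q : OnePoint ℂ} (hσ : (lift g σ).IsParabolicAt p) (hτ : (lift g τ).IsParabolicAt q)
    (hpq : p ≠ q) : NoCommonTurn σ τ := by
  intro u s t hs ht hs0 ht0 es et h₁ h₂
  apply hpq
  have conj {σ : FreeGroup (Fin 2)} {s : List (Fin 2 × Bool)} {p : OnePoint ℂ}
      (hσ : (lift g σ).IsParabolicAt p) (es : u * σ * u⁻¹ = FreeGroup.mk s) :
      (lift g (FreeGroup.mk s)).IsParabolicAt (lift g u • p) := by
    rw [← es, _root_.map_mul, _root_.map_mul, _root_.map_inv]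
    exact hσ.conj _
  have last {s : List (Fin 2 × Bool)} {p : OnePoint ℂ} (hs : IsCyclicallyReduced s)
      (hp : (lift g (FreeGroup.mk s)).IsParabolicAt p) {y : Fin 2 × Bool} (hy : y ∈ s.getLast?) :
      p ∉ (letterCircle C C' (letterInv y)).exterior := by
    refine h.fixedPoint_notMem_exterior hs.invRev (p := p) ?_ ?_
    · rw [← inv_mk, _root_.map_inv]
      exact hp.inv
    · rw [head?_invRev, Option.mem_map]
      exact ⟨y, hy, rfl⟩
  obtain ⟨x, l, rfl⟩ := List.exists_cons_of_ne_nil hs0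
  obtain ⟨y, hy⟩ : ∃ y, (x :: l).getLast? = some y :=
    ⟨_, List.getLast?_eq_some_getLast (List.cons_ne_nil x l)⟩
  have hxy : x ≠ letterInv y := not_cancel_iff.1 (hs.2 y hy x rfl)
  obtain ⟨z, hzx, hzy⟩ := exists_ne_letter x (letterInv y)
  refine MulAction.injective (lift g u) (OrientedCircle.eq_of_notMem_exterior
    (h.disjoint_letterCircle hxy) (h.disjoint_letterCircle hzx) (h.disjoint_letterCircle hzy)
    (h.fixedPoint_notMem_exterior hs (conj hσ es) rfl) (last hs (conj hσ es) hy)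
    (h.fixedPoint_notMem_exterior ht (conj hτ et) h₁.symm) (last ht (conj hτ et) (h₂ ▸ hy)))

end IsClassicalTSchottkyConfiguration

/-! ### Conclusion -/

lemma FreeGroup.mul_ne_mul_of_closure_eq_top {σ τ : FreeGroup (Fin 2)}
    (h : Subgroup.closure {σ, τ} = ⊤) : σ * τ ≠ τ * σ := by
  intro hc
  have comm (x y : FreeGroup (Fin 2)) : x * y = y * x := by
    have step {z : FreeGroup (Fin 2)} (h₁ : σ * z = z * σ) (h₂ : τ * z = z * τ)
        (x : FreeGroup (Fin 2)) : x * z = z * x := by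
      have hle : Subgroup.closure {σ, τ} ≤ Subgroup.centralizer {z} := by
        rw [Subgroup.closure_le, Set.insert_subset_iff, Set.singleton_subset_iff]
        exact ⟨Subgroup.mem_centralizer_singleton_iff.2 h₁,
          Subgroup.mem_centralizer_singleton_iff.2 h₂⟩
      exact Subgroup.mem_centralizer_singleton_iff.1 (hle (h ▸ Subgroup.mem_top x))
    exact step (step rfl hc.symm y).symm (step hc rfl y).symm x
  exact absurd (comm (of 0) (of 1)) (by decide)

theorem theorem6p5 (G : Subgroup Mobius) (A B S T : Mobius)
    (hAB : IsMarkedClassicalTSchottky G ![A, B])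
    (hS : S.IsParabolic) (hT : T.IsParabolic)
    (hST : Subgroup.closure {S, T} = G) :
    ∃ A' B' S' T' : Mobius, ∃ h ∈ G,
      IsSwapInvOf (A, B) (A', B') ∧ IsSwapInvOf (S, T) (S', T') ∧
      ((h * S' * h⁻¹ = A' ∧ h * T' * h⁻¹ = B') ∨
        (h * S' * h⁻¹ = A' ∧ h * T' * h⁻¹ = A' * B')) := by
  obtain ⟨hG, C, C', hC⟩ := hAB
  have hinj := hC.lift_injective
  set f : FreeGroup (Fin 2) →* Mobius := lift ![A, B] with hf
  have hrange : f.range = G := by rw [hf, range_lift_eq_closure, hG]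
  have hSG : S ∈ f.range := by
    rw [hrange, ← hST]; exact Subgroup.subset_closure (by simp)
  have hTG : T ∈ f.range := by
    rw [hrange, ← hST]; exact Subgroup.subset_closure (by simp)
  obtain ⟨σ, rfl⟩ := hSG
  obtain ⟨τ, rfl⟩ := hTG
  have htop : Subgroup.closure {σ, τ} = ⊤ := by
    apply Subgroup.map_injective hinj
    rw [MonoidHom.map_closure, Set.image_pair, hST, ← hrange]
    exact f.range_eq_map
  obtain ⟨p, hp⟩ := hS.exists_isParabolicAt
  obtain ⟨q, hq⟩ := hT.exists_isParabolicAt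
  have hcomm := mul_ne_mul_of_closure_eq_top htop
  -- Parabolics with a common fixed point commute, but generators of a nonabelian group do not.
  have hpq : p ≠ q := by
    rintro rfl
    exact hcomm (hinj (by simpa using hp.commute hq))
  have htrans : IsTransversePair σ τ :=
    { closure_eq_top := htop
      left_ne_one := by rintro rfl; simp at hcomm
      right_ne_one := by rintro rfl; simp at hcomm
      noCommonTurn := hC.noCommonTurn hp hq hpq
      noCommonTurn_inv := hC.noCommonTurn hp (by simpa using hq.inv) hpq }
  obtain ⟨a, b, σ', τ', u, h₁, h₂, h₃, h₄⟩ := isStandardPair_of_isTransversePair htrans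
  refine ⟨f a, f b, f σ', f τ', f u, hrange ▸ ⟨u, rfl⟩, ?_, h₂.map f, ?_⟩
  · simpa [hf] using h₁.map f
  · simp only [← _root_.map_mul, ← _root_.map_inv, h₃, true_and]
    exact h₄.imp (congrArg f) (congrArg f)
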